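/- Let $\mathcal X,\mathcal Y,\mathcal Z$ be finite sets, $d=|\mathcal Z|$, let $f:\mathcal X\times\mathcal Y\to\mathcal Z\cup\{\bot\}$ be a partial function ($\bot$ means undefined), and let $\mu=\mu_X\otimes\mu_Y$ be a product probability distribution on $\mathcal X\times\mathcal Y$ supported on $f^{-1}(\mathcal Z)$. In a one-way protocol Alice gets $x$, sends a single message to Bob, and Bob, who has $y$, outputs an element of $\mathcal Z$. In a classical protocol the message is a bit string, and public and private randomness, independent of the inputs, are allowed. In a quantum protocol Alice sends a quantum state of some number of qubits and Bob measures it. In an entanglement-assisted quantum protocol the parties moreover share at the start a finite-dimensional pure state independent of the inputs; Alice applies to her part a quantum channel depending on $x$, whose output qubits she sends, and Bob measures the message together with his part, with a measurement depending on $y$. The error of a protocol at $(x,y)$ is the probability that the output differs from $f(x,y)$, and is $0$ if $f(x,y)=\bot$. For $\delta\ge 0$ let $\mathsf R^{1,\mu}_\delta(f)$, $\mathsf Q^{1,\mu}_\delta(f)$, $\mathsf Q^{1,\mu,*}_\delta(f)$ be the minimal number of bits (respectively qubits) of the message in a classical, quantum, entanglement-assisted quantum one-way protocol whose error, averaged over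 $(x,y)\leftarrow\mu$, is at most $\delta$. For $T\subseteq\mathcal Y$ let $\mathsf R^{1,\mu_X,T}_\delta(f)$, $\mathsf Q^{1,\mu_X,T}_\delta(f)$, $\mathsf Q^{1,\mu_X,T,*}_\delta(f)$ be the same minima for protocols such that, for every $y\in T$, the error averaged over $x\leftarrow\mu_X$ is at most $\delta$. There is an absolute constant $C>0$ such that, for all such $\mathcal X,\mathcal Y,\mathcal Z,f,\mu$ and all reals $\eta>0$ and $0\le\epsilon\le 1-1/d$, with $$\epsilon'=2\epsilon-\frac{d\epsilon^2}{d-1}+\eta,\qquad L=C\log_2\max\{2,\log_2(1/\eta)\}$$ (so $L=C\log_2\log_2(1/\eta)$ for $\eta\le 1/4$ and $L=C$ for $\eta\geq 1/4$; the quotient is read as $0$ if $d=1$), $$\mathsf R^{1,\mu}_{\epsilon'}(f)\le 2\,\mathsf Q^{1,\mu,*}_{\epsilon}(f)+L,\qquad \mathsf R^{1,\mu}_{\epsilon'}(f)\le \mathsf Q^{1,\mu}_{\epsilon}(f)+L,$$ and, for every $T\subseteq\mathcal Y$ such that $f(x,y)\ne\bot$ whenever $\mu_X(x)>0$ and $y\in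 T$, $$\mathsf R^{1,\mu_X,T}_{\epsilon'}(f)\le 2\,\mathsf Q^{1,\mu_X,T,*}_{\epsilon}(f)+L,\qquad \mathsf R^{1,\mu_X,T}_{\epsilon'}(f)\le \mathsf Q^{1,\mu_X,T}_{\epsilon}(f)+L.$$ (One may always take $T=\operatorname{supp}\mu_Y$, and $T=\mathcal Y$ if $f$ is defined on $\operatorname{supp}(\mu_X)\times\mathcal Y$, in particular if $f$ is total.) -/

import Mathlib

open scoped ENNReal Matrix Kronecker ComplexOrder

namespace OneWay

/-! ### Distributions on `X × Y` -/

section Distributions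

variable {X Y : Type*} [Fintype X] [Fintype Y]

/-- The marginal of `μ` on Alice's inputs. -/
def marginalX (μ : X × Y → ℝ) (x : X) : ℝ := ∑ y, μ (x, y)

/-- The marginal of `μ` on Bob's inputs. -/
def marginalY (μ : X × Y → ℝ) (y : Y) : ℝ := ∑ x, μ (x, y)

/-- `μ` is a product distribution: it is the product of its marginals. -/
def IsProductDist (μ : X × Y → ℝ) : Prop :=
  μ ∈ stdSimplex ℝ (X × Y) ∧ ∀ x y, μ (x, y) = marginalX μ x * marginalY μ y

end Distributions

/-! ### Protocols

Each protocol is given with its output law: `P.out x y z` is the probability that Bob outputs `z`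
when the inputs are `x` and `y`. -/

/-- One-way classical protocols with a message of `c` bits. The public randomness is a random
seed, independent of the inputs and known to both parties. Private randomness appears in that,
given the seed, Alice chooses her message from a probability distribution depending on `x`, and
Bob chooses his output from a probability distribution depending on the message and on `y`. -/
structure ClassicalProtocol (X Y Z : Type*) [Fintype Z] (c : ℕ) where
  /-- number of values of the public seed -/
  seeds : ℕ
  /-- law of the public seed -/
  pub : Fin seeds → ℝ
  pub_mem : pub ∈ stdSimplex ℝ (Fin seeds)
  /-- law of Alice's message given the seed and `x` -/
  alice : Fin seeds → X → (Fin c → Bool) → ℝ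
  alice_mem : ∀ r x, alice r x ∈ stdSimplex ℝ (Fin c → Bool)
  /-- law of Bob's output given the seed, the message and `y` -/
  bob : Fin seeds → (Fin c → Bool) → Y → Z → ℝ
  bob_mem : ∀ r m y, bob r m y ∈ stdSimplex ℝ Z

/-- Output law of a classical protocol. -/
def ClassicalProtocol.out {X Y Z : Type*} [Fintype Z] {c : ℕ}
    (P : ClassicalProtocol X Y Z c) (x : X) (y : Y) (z : Z) : ℝ :=
  ∑ r, P.pub r * ∑ m, P.alice r x m * P.bob r m y z

/-- One-way quantum protocols without shared entanglement and with a message of `q` qubits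
(the Hilbert space with orthonormal basis `{0,1}^q`): on input `x` Alice sends the state `ρ x`,
and on input `y` Bob performs the measurement with POVM elements `E y z` and outputs the
outcome `z`. -/
structure QuantumProtocol (X Y Z : Type*) [Fintype Z] (q : ℕ) where
  /-- Alice's message -/
  ρ : X → Matrix (Fin q → Bool) (Fin q → Bool) ℂ
  ρ_pos : ∀ x, (ρ x).PosSemidef
  ρ_trace : ∀ x, (ρ x).trace = 1
  /-- Bob's POVM -/
  E : Y → Z → Matrix (Fin q → Bool) (Fin q → Bool) ℂ
  E_pos : ∀ y z, (E y z).PosSemidef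
  E_sum : ∀ y, ∑ z, E y z = 1

/-- Output law of a quantum protocol (Born rule). -/
noncomputable def QuantumProtocol.out {X Y Z : Type*} [Fintype Z] {q : ℕ}
    (P : QuantumProtocol X Y Z q) (x : X) (y : Y) (z : Z) : ℝ :=
  (P.E y z * P.ρ x).trace.re

/-- One-way entanglement-assisted quantum protocols with a message of `q` qubits. Alice and Bob
share a pure state `ψ` on `ℂ^a ⊗ ℂ^b`, of arbitrary finite dimensions. On input `x` Alice applies
an arbitrary quantum channel, with Kraus operators `K x i`, from her part of `ψ` to the register
of `q` qubits, which she sends to Bob. On input `y` Bob measures the message together with his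
part of `ψ`, with POVM elements `E y z`, and outputs the outcome `z`. -/
structure EntangledProtocol (X Y Z : Type*) [Fintype Z] (q : ℕ) where
  /-- dimension of Alice's part of the shared state -/
  a : ℕ
  /-- dimension of Bob's part of the shared state -/
  b : ℕ
  /-- the shared pure state -/
  ψ : Fin a × Fin b → ℂ
  ψ_norm : ∑ i, ‖ψ i‖ ^ 2 = 1
  /-- number of Kraus operators of Alice's channels -/
  k : ℕ
  /-- Kraus operators of Alice's channel on input `x` -/
  K : X → Fin k → Matrix (Fin q → Bool) (Fin a) ℂ
  K_sum : ∀ x, ∑ i, (K x i)ᴴ * K x i = 1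
  /-- Bob's POVM -/
  E : Y → Z → Matrix ((Fin q → Bool) × Fin b) ((Fin q → Bool) × Fin b) ℂ
  E_pos : ∀ y z, (E y z).PosSemidef
  E_sum : ∀ y, ∑ z, E y z = 1

/-- The joint state of the message and of Bob's part of the shared state, on input `x`:
Alice's channel applied to her half of `|ψ⟩⟨ψ|`. -/
noncomputable def EntangledProtocol.state {X Y Z : Type*} [Fintype Z] {q : ℕ}
    (P : EntangledProtocol X Y Z q) (x : X) :
    Matrix ((Fin q → Bool) × Fin P.b) ((Fin q → Bool) × Fin P.b) ℂ :=
  ∑ i, (P.K x i ⊗ₖ (1 : Matrix (Fin P.b) (Fin P.b) ℂ)) * Matrix.vecMulVec P.ψ (star P.ψ) *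
    (P.K x i ⊗ₖ (1 : Matrix (Fin P.b) (Fin P.b) ℂ))ᴴ

/-- Output law of an entanglement-assisted protocol (Born rule). -/
noncomputable def EntangledProtocol.out {X Y Z : Type*} [Fintype Z] {q : ℕ}
    (P : EntangledProtocol X Y Z q) (x : X) (y : Y) (z : Z) : ℝ :=
  (P.E y z * P.state x).trace.re

/-! ### Errors

The partial function is `f : X → Y → Option Z`, with `none` for "undefined". -/

section Errors

variable {X Y Z : Type*} [Fintype X] [Fintype Y] [Fintype Z] [DecidableEq Z]

/-- Probability that the output on `(x, y)` differs from `f x y`; `0` where `f` is undefined. -/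
def errAt (f : X → Y → Option Z) (out : X → Y → Z → ℝ) (x : X) (y : Y) : ℝ :=
  match f x y with
  | none => 0
  | some z => ∑ z' ∈ Finset.univ.filter (fun z' => z' ≠ z), out x y z'

/-- Error averaged over `(x, y)` drawn from `μ`. -/
def avgErr (f : X → Y → Option Z) (μ : X × Y → ℝ) (out : X → Y → Z → ℝ) : ℝ :=
  ∑ x, ∑ y, μ (x, y) * errAt f out x y

/-- Error averaged over `x` drawn from `μX`, in the worst case over `y ∈ T`
(a maximum of finitely many reals). -/
noncomputable def worstErr (f : X → Y → Option Z) (μX : X → ℝ) (T : Set Y)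
    (out : X → Y → Z → ℝ) : ℝ :=
  ⨆ y : T, ∑ x, μX x * errAt f out x y

/-! ### Communication complexities

Minimal message lengths, as elements of `ℕ∞`. -/

/-- Classical one-way complexity with average error at most `ε` over `μ`. -/
noncomputable def RAvg (f : X → Y → Option Z) (μ : X × Y → ℝ) (ε : ℝ) : ℕ∞ :=
  ⨅ (c : ℕ) (_ : ∃ P : ClassicalProtocol X Y Z c, avgErr f μ P.out ≤ ε), (c : ℕ∞)

/-- Quantum one-way complexity with average error at most `ε` over `μ`. -/
noncomputable def QAvg (f : X → Y → Option Z) (μ : X × Y → ℝ) (ε : ℝ) : ℕ∞ :=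
  ⨅ (q : ℕ) (_ : ∃ P : QuantumProtocol X Y Z q, avgErr f μ P.out ≤ ε), (q : ℕ∞)

/-- Entanglement-assisted one-way complexity with average error at most `ε` over `μ`. -/
noncomputable def QEntAvg (f : X → Y → Option Z) (μ : X × Y → ℝ) (ε : ℝ) : ℕ∞ :=
  ⨅ (q : ℕ) (_ : ∃ P : EntangledProtocol X Y Z q, avgErr f μ P.out ≤ ε), (q : ℕ∞)

/-- Classical one-way complexity; error averaged over `x`, worst case over `y ∈ T`. -/
noncomputable def RWorst (f : X → Y → Option Z) (μX : X → ℝ) (T : Set Y) (ε : ℝ) : ℕ∞ :=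
  ⨅ (c : ℕ) (_ : ∃ P : ClassicalProtocol X Y Z c, worstErr f μX T P.out ≤ ε), (c : ℕ∞)

/-- Quantum one-way complexity; error averaged over `x`, worst case over `y ∈ T`. -/
noncomputable def QWorst (f : X → Y → Option Z) (μX : X → ℝ) (T : Set Y) (ε : ℝ) : ℕ∞ :=
  ⨅ (q : ℕ) (_ : ∃ P : QuantumProtocol X Y Z q, worstErr f μX T P.out ≤ ε), (q : ℕ∞)

/-- Entanglement-assisted one-way complexity; error averaged over `x`, worst case over
`y ∈ T`. -/
noncomputable def QEntWorst (f : X → Y → Option Z) (μX : X → ℝ) (T : Set Y) (ε : ℝ) : ℕ∞ :=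
  ⨅ (q : ℕ) (_ : ∃ P : EntangledProtocol X Y Z q, worstErr f μX T P.out ≤ ε), (q : ℕ∞)

end Errors

/-- `log₂ log₂ (1/η)` for `0 < η ≤ 1/4`, and `1` for `η ≥ 1/4`. -/
noncomputable def logLog (η : ℝ) : ℝ :=
  Real.logb 2 (max 2 (Real.logb 2 (1 / η)))

end OneWay

/-! Instead of the quantum message, Bob can use a good guess `x'` of `x`, to which he applies `f(·,
y)`. Take for `x'` the outcome of the pretty good measurement (PGM) of Alice's states weighted by
`μX`. It does not involve `y`, and grouping its outcomes by the value of `f(·, y)` gives the PGM of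
the grouped ensemble; so for every `y` it competes with Bob's own measurement. If that one succeeds
with probability `p`, a centred Cauchy–Schwarz inequality (`prettyGood_success_ge`) gives the PGM
success at least `1/d + d/(d-1) (p - 1/d)^2`; for `p = 1 - ε` this is error at most `2ε -
dε²/(d-1)`.

The guess is cheap to send. If one operator `τ` dominates all of Alice's states, the laws of the
guess have density at most `tr τ` with respect to a common law (`exists_prettyGood_guess`).
Rejection sampling from public candidates (`exists_sampling_protocol`) then costs `log₂ tr τ` bits,
plus about `log₂ log₂ (1/η)` to fail with probability at most `η`. Without entanglement `τ = 1`, of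
trace `2^q`; with it `τ = 2^q (1 ⊗ ρ_B)`, of trace `4^q`, whence the factor 2.

Since `μ` is a product, the ensemble is the same for all `y`; the average over `y` is handled by
concavity of the error bound. -/

namespace OneWay

/-! ### Positive matrices and the pretty good measurement bound -/

section PositiveMatrices

variable {n : Type*} [Fintype n]

/-- The squared Hilbert–Schmidt norm of `sF - tB + uG`, expanded. -/
lemma trace_quadratic_nonneg {F B G : Matrix n n ℂ} (hF : F.IsHermitian) (hB : B.IsHermitian)
    (hG : G.IsHermitian) (s t u : ℝ) :
    0 ≤ s ^ 2 * (F * F).trace.re + t ^ 2 * (B * B).trace.re + u ^ 2 * (G * G).trace.re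
      - 2 * s * t * (F * B).trace.re + 2 * s * u * (F * G).trace.re
      - 2 * t * u * (B * G).trace.re := by
  set A : Matrix n n ℂ := s • F - t • B + u • G with hA
  have hAH : Aᴴ = A := by
    simp [hA, Matrix.conjTranspose_add, Matrix.conjTranspose_sub, Matrix.conjTranspose_smul,
      hF.eq, hB.eq, hG.eq]
  have h := (Complex.le_def.1 (Matrix.posSemidef_conjTranspose_mul_self A).trace_nonneg).1
  rw [hAH] at h
  simp only [hA, Matrix.add_mul, Matrix.sub_mul, Matrix.mul_add, Matrix.mul_sub, Matrix.smul_mul,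
    Matrix.mul_smul, Matrix.trace_add, Matrix.trace_sub, Matrix.trace_smul, Complex.add_re,
    Complex.sub_re, Complex.smul_re, smul_eq_mul, Complex.zero_re, Matrix.trace_mul_comm B F,
    Matrix.trace_mul_comm G F, Matrix.trace_mul_comm G B] at h
  linarith

variable [DecidableEq n]

/-- A positive semidefinite matrix has a Hermitian fourth root `R`, which has a Hermitian
pseudo-inverse `T` commuting with it. -/
lemma exists_fourth_root {A : Matrix n n ℂ} (hA : A.PosSemidef) :
    ∃ R T : Matrix n n ℂ, R.IsHermitian ∧ T.IsHermitian ∧ R * R * (R * R) = A ∧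
      R * T = T * R ∧ R * T * R = R ∧ T * R * T = T := by
  set U : Matrix n n ℂ := (hA.1.eigenvectorUnitary : Matrix n n ℂ) with hU
  have hUU : star U * U = 1 := by simp [hU]
  let φ : (n → ℝ) → Matrix n n ℂ := fun d => U * Matrix.diagonal (fun i => (d i : ℂ)) * star U
  have hmul : ∀ d e, φ d * φ e = φ (fun i => d i * e i) := by
    intro d e
    have : φ d * φ e = U * Matrix.diagonal (fun i => (d i : ℂ)) * (star U * U) *
        Matrix.diagonal (fun i => (e i : ℂ)) * star U := by
      simp only [φ, Matrix.mul_assoc]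
    rw [this, hUU, Matrix.mul_one, Matrix.mul_assoc U, Matrix.diagonal_mul_diagonal]
    simp [φ]
  have hherm : ∀ d, (φ d).IsHermitian := by
    intro d
    simp [φ, Matrix.IsHermitian, Matrix.conjTranspose_mul, Matrix.star_eq_conjTranspose,
      Matrix.mul_assoc, Matrix.diagonal_conjTranspose, Pi.star_def]
  have hspec : A = φ hA.1.eigenvalues := by
    conv_lhs => rw [hA.1.spectral_theorem, Unitary.conjStarAlgAut_apply]
    simp [φ, hU, Function.comp_def]
  let r : n → ℝ := fun i => Real.sqrt (Real.sqrt (hA.1.eigenvalues i))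
  -- The convention `0⁻¹ = 0` makes this a pseudo-inverse.
  refine ⟨φ r, φ (fun i => (r i)⁻¹), hherm _, hherm _, ?_, ?_, ?_, ?_⟩
  · rw [hmul, hmul]
    conv_rhs => rw [hspec]
    congr 1
    funext i
    simp only [r, Real.mul_self_sqrt (Real.sqrt_nonneg _)]
    exact Real.mul_self_sqrt (hA.eigenvalues_nonneg i)
  · rw [hmul, hmul]; congr 1; funext i; ring
  · rw [hmul, hmul]; congr 1; funext i; exact mul_inv_mul_cancel (r i)
  · rw [hmul, hmul]; congr 1; funext i; simpa using mul_inv_mul_cancel (r i)⁻¹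

lemma exists_hermitian_sq {A : Matrix n n ℂ} (hA : A.PosSemidef) :
    ∃ S : Matrix n n ℂ, S.IsHermitian ∧ S * S = A := by
  obtain ⟨R, -, hR, -, h, -⟩ := exists_fourth_root hA
  refine ⟨R * R, ?_, h⟩
  rw [Matrix.IsHermitian, Matrix.conjTranspose_mul, hR.eq]

lemma trace_mul_re_nonneg {A B : Matrix n n ℂ} (hA : A.PosSemidef) (hB : B.PosSemidef) :
    0 ≤ (A * B).trace.re := by
  obtain ⟨S, hS, rfl⟩ := exists_hermitian_sq hA
  have h := (hB.mul_mul_conjTranspose_same S).trace_nonneg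
  rw [hS.eq, Matrix.trace_mul_comm, ← Matrix.mul_assoc] at h
  exact (Complex.le_def.1 h).1

lemma trace_mul_re_mono {A A' B : Matrix n n ℂ} (hA : (A' - A).PosSemidef) (hB : B.PosSemidef) :
    (A * B).trace.re ≤ (A' * B).trace.re := by
  have h := trace_mul_re_nonneg hA hB
  rw [Matrix.sub_mul, Matrix.trace_sub, Complex.sub_re] at h
  linarith

/-- A positive semidefinite matrix dominated by `A` vanishes where `A` does. -/
lemma mul_eq_zero_of_dominated {A B N : Matrix n n ℂ} {c : ℝ} (hc : 0 < c) (hB : B.PosSemidef)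
    (hAB : (A - c • B).PosSemidef) (hN : A * N = 0) : B * N = 0 := by
  obtain ⟨S, hS, rfl⟩ := exists_hermitian_sq hB
  -- With `B = S * S`, this trace equals `-c ‖S N‖²`, which forces `S N = 0`.
  have h := (hAB.conjTranspose_mul_mul_same N).trace_nonneg
  rw [Matrix.mul_assoc, Matrix.sub_mul, hN, zero_sub, Matrix.mul_neg, Matrix.smul_mul,
    Matrix.mul_smul, Matrix.trace_neg, Matrix.trace_smul] at h
  have h1 : Nᴴ * (S * S * N) = (S * N)ᴴ * (S * N) := by
    rw [Matrix.conjTranspose_mul, hS.eq]; simp only [Matrix.mul_assoc]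
  have h2 := (Matrix.posSemidef_conjTranspose_mul_self (S * N)).trace_nonneg
  rw [h1] at h
  have h3 : ((S * N)ᴴ * (S * N)).trace = 0 := by
    rw [Complex.le_def] at h h2
    simp only [Complex.zero_re, Complex.zero_im, Complex.neg_re, Complex.neg_im, Complex.smul_re,
      Complex.smul_im, smul_eq_mul] at h h2
    apply Complex.ext
    · simp only [Complex.zero_re]
      nlinarith
    · exact h2.2.symm
  have h4 := Matrix.trace_conjTranspose_mul_self_eq_zero_iff.1 h3
  rw [Matrix.mul_assoc, h4, Matrix.mul_zero]

/-- Lower bound on the success probability of the pretty good measurement. The ensemble is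
`σ`, with average `(R * R) * (R * R)`, the square of the matrix `T` is its inverse square root,
and `E` is any competing measurement. -/
theorem prettyGood_success_ge {Z : Type*} [Fintype Z] [Nonempty Z]
    {σ E : Z → Matrix n n ℂ} {R T : Matrix n n ℂ}
    (hσ : ∀ z, (σ z).IsHermitian) (hE : ∀ z, (E z).PosSemidef) (hEsum : ∑ z, E z = 1)
    (hR : R.IsHermitian) (hT : T.IsHermitian)
    (hRT : R * T = T * R) (hRTR : R * T * R = R)
    (hsum : ∑ z, σ z = R * R * (R * R)) (htr : (R * R * (R * R)).trace = 1)
    (hsupp : ∀ z, σ z * (T * R) = σ z) :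
    1 / (Fintype.card Z : ℝ) + Fintype.card Z / (Fintype.card Z - 1) *
        (∑ z, (E z * σ z).trace.re - 1 / (Fintype.card Z : ℝ)) ^ 2 ≤
      ∑ z, (σ z * (T * T) * (σ z * (T * T))).trace.re := by
  classical
  set d : ℝ := ((Fintype.card Z : ℕ) : ℝ) with hd
  have hd1 : 1 ≤ d := by
    rw [hd]; exact_mod_cast Fintype.card_pos
  set p : ℝ := ∑ z, (E z * σ z).trace.re with hp
  set b : ℝ := ∑ z, (σ z * (T * T) * (σ z * (T * T))).trace.re with hb
  have hsupp' : ∀ z, R * T * σ z = σ z := by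
    intro z
    have h := congrArg Matrix.conjTranspose (hsupp z)
    rwa [Matrix.conjTranspose_mul, Matrix.conjTranspose_mul, hR.eq, hT.eq, (hσ z).eq] at h
  -- With `A` the average state, put `F_z = A^(1/4) E_z A^(1/4)` and `B_z = A^(-1/4) σ_z A^(-1/4)`.
  -- Both families sum to `G = A^(1/2)`, of Hilbert–Schmidt norm 1; the products `⟨F_z, B_z⟩` sum to
  -- `p` and the `‖B_z‖²` to `b`.
  have hGH : (R * R).IsHermitian := by
    rw [Matrix.IsHermitian, Matrix.conjTranspose_mul, hR.eq]
  have hFH : ∀ z, (R * E z * R).IsHermitian := by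
    intro z
    rw [Matrix.IsHermitian, Matrix.conjTranspose_mul, Matrix.conjTranspose_mul, hR.eq,
      (hE z).1.eq, Matrix.mul_assoc]
  have hBH : ∀ z, (T * σ z * T).IsHermitian := by
    intro z
    rw [Matrix.IsHermitian, Matrix.conjTranspose_mul, Matrix.conjTranspose_mul, hT.eq,
      (hσ z).eq, Matrix.mul_assoc]
  have hFsum : ∑ z, R * E z * R = R * R := by
    rw [← Finset.sum_mul, ← Finset.mul_sum, hEsum, Matrix.mul_one]
  have hBsum : ∑ z, T * σ z * T = R * R := by
    rw [← Finset.sum_mul, ← Finset.mul_sum, hsum]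
    have h1 : T * R * R = R := by rw [← hRT, hRTR]
    have h2 : R * (R * T) = R := by rw [hRT, ← Matrix.mul_assoc, hRTR]
    calc T * (R * R * (R * R)) * T = (T * R * R) * (R * (R * T)) := by
          simp only [Matrix.mul_assoc]
      _ = R * R := by rw [h1, h2]
  have hFB : ∀ z, (R * E z * R * (T * σ z * T)).trace.re = (E z * σ z).trace.re := by
    intro z
    calc (R * E z * R * (T * σ z * T)).trace.re
        = ((R * E z) * ((R * T * σ z) * T)).trace.re := by simp only [Matrix.mul_assoc]
      _ = (E z * (σ z * (T * R))).trace.re := by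
          rw [hsupp', Matrix.mul_assoc, Matrix.trace_mul_comm R]; simp only [Matrix.mul_assoc]
      _ = _ := by rw [hsupp]
  have hBB : ∀ z, (T * σ z * T * (T * σ z * T)).trace.re =
      (σ z * (T * T) * (σ z * (T * T))).trace.re := by
    intro z
    rw [Matrix.mul_assoc T, Matrix.mul_assoc T, Matrix.trace_mul_comm T]
    simp only [Matrix.mul_assoc]
  have ha : ∑ z, (R * E z * R * (R * E z * R)).trace.re ≤ 1 := by
    have hz : ∀ z, (R * E z * R * (R * E z * R)).trace.re ≤
        (E z * (R * R * (R * R))).trace.re := by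
      intro z
      have hle : (1 - E z).PosSemidef := by
        rw [← hEsum, ← Finset.add_sum_erase _ _ (Finset.mem_univ z), add_sub_cancel_left]
        exact Matrix.posSemidef_sum _ fun i _ => hE i
      have h := trace_mul_re_mono hle ((hE z).mul_mul_conjTranspose_same (R * R))
      rw [hGH.eq, Matrix.one_mul] at h
      calc (R * E z * R * (R * E z * R)).trace.re
          = (E z * (R * R * E z * (R * R))).trace.re := by
            rw [Matrix.mul_assoc R, Matrix.mul_assoc R, Matrix.trace_mul_comm R]
            simp only [Matrix.mul_assoc]
        _ ≤ (R * R * E z * (R * R)).trace.re := h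
        _ = _ := by
            rw [Matrix.mul_assoc (R * R), Matrix.trace_mul_comm (R * R), Matrix.mul_assoc]
    refine (Finset.sum_le_sum fun z _ => hz z).trans (le_of_eq ?_)
    rw [← Complex.re_sum, ← Matrix.trace_sum, ← Finset.sum_mul, hEsum, Matrix.one_mul, htr,
      Complex.one_re]
  -- The coefficient `(t - s) / d` of `G` centres both families: the matrix squared is `s (F_z -
  -- G/d) - t (B_z - G/d)`.
  have key : ∀ s t : ℝ, 0 ≤ s ^ 2 * 1 + t ^ 2 * b - 2 * s * t * p - (t - s) ^ 2 / d := by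
    intro s t
    have h := Finset.sum_nonneg fun z (_ : z ∈ Finset.univ) =>
      trace_quadratic_nonneg (hFH z) (hBH z) hGH s t ((t - s) / d)
    simp only [Finset.sum_add_distrib, Finset.sum_sub_distrib, ← Finset.mul_sum] at h
    have e1 : ∑ z, (R * E z * R * (R * R)).trace.re = 1 := by
      rw [← Complex.re_sum, ← Matrix.trace_sum, ← Finset.sum_mul, hFsum, htr, Complex.one_re]
    have e2 : ∑ z, (T * σ z * T * (R * R)).trace.re = 1 := by
      rw [← Complex.re_sum, ← Matrix.trace_sum, ← Finset.sum_mul, hBsum, htr, Complex.one_re]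
    rw [e1, e2, htr, Finset.sum_congr rfl fun z _ => hFB z, Finset.sum_congr rfl fun z _ => hBB z,
      Finset.sum_const, Finset.card_univ, nsmul_eq_mul, Complex.one_re, ← hd, ← hp, ← hb] at h
    have h5 := mul_le_mul_of_nonneg_left ha (sq_nonneg s)
    have h6 : ((t - s) / d) ^ 2 * (d * 1) + 2 * s * ((t - s) / d) - 2 * t * ((t - s) / d)
        = - ((t - s) ^ 2 / d) := by
      field_simp; ring
    linarith
  rcases hd1.eq_or_lt with h1 | h1
  -- For `d = 1` the quotient `d / (d - 1)` is `0`, and the claim is `b ≥ 1`.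
  · have h := key 0 1
    rw [← h1] at h ⊢
    norm_num at h ⊢
    exact h
  · have hd0 : 0 < d - 1 := by linarith
    -- The form is `s²(1 - 1/d) + t²(b - 1/d) - 2st(p - 1/d)`; for this `t`, the chosen `s`
    -- minimises it.
    have h := key (p - 1 / d) (1 - 1 / d)
    have h7 : (p - 1 / d) ^ 2 * 1 + (1 - 1 / d) ^ 2 * b - 2 * (p - 1 / d) * (1 - 1 / d) * p
        - (1 - 1 / d - (p - 1 / d)) ^ 2 / d =
        ((d - 1) / d) ^ 2 * (b - (1 / d + d / (d - 1) * (p - 1 / d) ^ 2)) := by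
      field_simp; ring
    rw [h7] at h
    have h8 : 0 < ((d - 1) / d) ^ 2 := by positivity
    linarith [nonneg_of_mul_nonneg_right h h8]

end PositiveMatrices

/-! ### Guessing the input by the pretty good measurement -/

/-- For an ensemble of states dominated by `τ`, guessing by the pretty good measurement: `W x` is
the law of the guess on input `x`. It has relative density at most `K` with respect to a law `ν`
independent of `x`, and the guess agrees with the true input under `g` almost as often as the
outcome of any measurement agrees with the value of `g`. -/
theorem exists_prettyGood_guess {X : Type*} {n : Type*} {Z : Type*}
    [Fintype X] [Fintype n] [DecidableEq n] [Fintype Z] [DecidableEq Z] [Nonempty Z]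
    {μ : X → ℝ} (hμ : μ ∈ stdSimplex ℝ X) {ρ : X → Matrix n n ℂ}
    (hρ : ∀ x, (ρ x).PosSemidef) (hρtr : ∀ x, (ρ x).trace = 1)
    {τ : Matrix n n ℂ} (hτ : τ.PosSemidef) (hle : ∀ x, (τ - ρ x).PosSemidef)
    {K : ℝ} (hK : τ.trace.re ≤ K) :
    ∃ (W : X → X → ℝ) (ν : X → ℝ), ν ∈ stdSimplex ℝ X ∧ (∀ x, W x ∈ stdSimplex ℝ X) ∧
      (∀ x x', W x x' ≤ K * ν x') ∧
      ∀ (E : Z → Matrix n n ℂ) (g : X → Z), (∀ z, (E z).PosSemidef) → ∑ z, E z = 1 →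
        1 / (Fintype.card Z : ℝ) + Fintype.card Z / (Fintype.card Z - 1) *
            (∑ x, μ x * (E (g x) * ρ x).trace.re - 1 / (Fintype.card Z : ℝ)) ^ 2 ≤
          ∑ x, μ x * ∑ x', if g x' = g x then W x x' else 0 := by
  classical
  have hμ0 := hμ.1
  have hA : (∑ x, μ x • ρ x).PosSemidef :=
    Matrix.posSemidef_sum _ fun x _ => (hρ x).smul (hμ0 x)
  obtain ⟨R, T, hR, hT, hRA, hRT, hRTR, hTRT⟩ := exists_fourth_root hA
  set Q := T * R with hQ
  have hQH : Qᴴ = Q := by rw [hQ, Matrix.conjTranspose_mul, hR.eq, hT.eq, hRT]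
  have hQQ : Q * Q = Q := by rw [hQ, ← Matrix.mul_assoc, hTRT]
  have hRQ : R * Q = R := by rw [hQ, ← Matrix.mul_assoc, hRTR]
  have hAtr : (∑ x, μ x • ρ x).trace = 1 := by
    rw [Matrix.trace_sum]
    simp only [Matrix.trace_smul, hρtr]
    rw [← Finset.sum_smul, hμ.2, one_smul]
  have hAN : (∑ x, μ x • ρ x) * (1 - Q) = 0 := by
    rw [← hRA, Matrix.mul_sub, Matrix.mul_one]
    simp only [Matrix.mul_assoc, hRQ, sub_self]
  have hsupp : ∀ x, 0 < μ x → ρ x * Q = ρ x := by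
    intro x hx
    have h : ρ x * (1 - Q) = 0 := by
      refine mul_eq_zero_of_dominated hx (hρ x) ?_ hAN
      rw [← Finset.add_sum_erase _ _ (Finset.mem_univ x), add_sub_cancel_left]
      exact Matrix.posSemidef_sum _ fun i _ => (hρ i).smul (hμ0 i)
    rw [Matrix.mul_sub, Matrix.mul_one, sub_eq_zero] at h
    exact h.symm
  have hSAS : (T * T) * (∑ x, μ x • ρ x) * (T * T) = Q := by
    rw [← hRA]
    have h1 : T * R * R = R := by rw [← hQ, ← hRT, hRTR]
    have h2 : R * (R * T) = R := by rw [hRT, hRQ]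
    calc (T * T) * (R * R * (R * R)) * (T * T)
        = T * (T * R * R) * (R * (R * T)) * T := by simp only [Matrix.mul_assoc]
      _ = Q := by rw [h1, h2, Matrix.mul_assoc, hRT, hQQ]
  have hSH : (T * T)ᴴ = T * T := by rw [Matrix.conjTranspose_mul, hT.eq]
  let M : X → Matrix n n ℂ := fun x => μ x • ((T * T) * ρ x * (T * T))
  have hM : ∀ x, (M x).PosSemidef := by
    intro x
    have h := (hρ x).mul_mul_conjTranspose_same (T * T)
    rw [hSH] at h
    exact h.smul (hμ0 x)
  have hMsum : ∑ x, M x = Q := by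
    rw [← hSAS, Finset.mul_sum, Finset.sum_mul]
    simp only [M, Matrix.mul_smul, Matrix.smul_mul]
  let W₀ : X → X → ℝ := fun x x' => (ρ x * M x').trace.re
  let w : X → ℝ := fun x' => (τ * M x').trace.re
  have hW₀w : ∀ x x', W₀ x x' ≤ w x' := fun x x' => trace_mul_re_mono (hle x) (hM x')
  have hW₀0 : ∀ x x', 0 ≤ W₀ x x' := fun x x' => trace_mul_re_nonneg (hρ x) (hM x')
  have hw0 : ∀ x', 0 ≤ w x' := fun x' => trace_mul_re_nonneg hτ (hM x')
  have hW₀sum : ∀ x, 0 < μ x → ∑ x', W₀ x x' = 1 := by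
    intro x hx
    rw [← Complex.re_sum, ← Matrix.trace_sum, ← Finset.mul_sum, hMsum, hsupp x hx, hρtr,
      Complex.one_re]
  obtain ⟨x₀, hx₀⟩ : ∃ x, 0 < μ x := by
    by_contra! h
    have h1 := Finset.sum_nonpos fun x (_ : x ∈ Finset.univ) => h x
    rw [hμ.2] at h1
    linarith
  set w₁ := ∑ x', w x' with hw₁
  have hw₁1 : 1 ≤ w₁ := (hW₀sum x₀ hx₀).symm.le.trans
    (Finset.sum_le_sum fun x' _ => hW₀w x₀ x')
  have hw₁K : w₁ ≤ K := by
    refine le_trans ?_ hK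
    rw [hw₁, ← Complex.re_sum, ← Matrix.trace_sum, ← Finset.mul_sum, hMsum]
    have h : (1 - Q).PosSemidef := by
      have h := Matrix.posSemidef_conjTranspose_mul_self (1 - Q)
      rwa [Matrix.conjTranspose_sub, hQH, Matrix.conjTranspose_one, Matrix.mul_sub,
        Matrix.mul_one, Matrix.sub_mul, hQQ, Matrix.one_mul, sub_self, sub_zero] at h
    have h1 := trace_mul_re_nonneg hτ h
    rw [Matrix.mul_sub, Matrix.mul_one, Matrix.trace_sub, Complex.sub_re] at h1
    linarith
  have hν : (fun x' => w x' / w₁) ∈ stdSimplex ℝ X :=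
    ⟨fun x' => div_nonneg (hw0 x') (by linarith), by
      rw [← Finset.sum_div]; exact div_self (by linarith)⟩
  have hwK : ∀ x', w x' ≤ K * (w x' / w₁) := by
    intro x'
    rw [mul_div_left_comm]
    exact le_mul_of_one_le_right (hw0 x') ((one_le_div (by linarith)).2 hw₁K)
  -- If `μ x = 0`, the state `ρ x` may leave the support `Q` of the average and `W₀ x` may have mass
  -- below 1; any law dominated by `K ν` will do there.
  refine ⟨fun x => if 0 < μ x then W₀ x else fun x' => w x' / w₁, fun x' => w x' / w₁, hν,
    ?_, ?_, ?_⟩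
  · intro x
    beta_reduce
    split_ifs with hx
    · exact ⟨hW₀0 x, hW₀sum x hx⟩
    · exact hν
  · intro x x'
    beta_reduce
    split_ifs with hx
    · exact (hW₀w x x').trans (hwK x')
    · exact le_mul_of_one_le_left (hν.1 x') (hw₁1.trans hw₁K)
  · intro E g hE hEsum
    let σ : Z → Matrix n n ℂ := fun z => ∑ x, if g x = z then μ x • ρ x else 0
    have hσ : ∀ z, (σ z).PosSemidef := by
      intro z
      refine Matrix.posSemidef_sum _ fun x _ => ?_
      split_ifs
      · exact (hρ x).smul (hμ0 x)
      · exact Matrix.PosSemidef.zero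
    have hσsum : ∑ z, σ z = R * R * (R * R) := by
      rw [hRA, Finset.sum_comm]
      simp
    have hσQ : ∀ z, σ z * (T * R) = σ z := by
      intro z
      simp only [σ, Finset.sum_mul]
      refine Finset.sum_congr rfl fun x _ => ?_
      split_ifs
      · rcases (hμ0 x).eq_or_lt with h | h
        · simp [← h]
        · rw [Matrix.smul_mul, hsupp x h]
      · exact Matrix.zero_mul _
    have h := prettyGood_success_ge (fun z => (hσ z).1) hE hEsum hR hT hRT hRTR hσsum
      (by rw [hRA, hAtr]) hσQ
    have e1 : ∑ z, (E z * σ z).trace.re = ∑ x, μ x * (E (g x) * ρ x).trace.re := by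
      simp only [σ, Finset.mul_sum, Matrix.trace_sum, Complex.re_sum]
      rw [Finset.sum_comm]
      refine Finset.sum_congr rfl fun x _ => ?_
      rw [Finset.sum_eq_single (g x)]
      · simp [Matrix.trace_smul]
      · intro z _ hz
        simp [Ne.symm hz]
      · simp
    -- Detailed balance: the joint law of input and PGM guess is symmetric.
    have hsymm : ∀ x x', μ x' * (ρ x' * M x).trace.re = μ x * (ρ x * M x').trace.re := by
      intro x x'
      simp only [M, Matrix.mul_smul, Matrix.trace_smul, Complex.smul_re, smul_eq_mul]
      rw [mul_left_comm]
      congr 3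
      rw [Matrix.trace_mul_comm (ρ x')]
      simp only [Matrix.mul_assoc]
      rw [Matrix.trace_mul_comm T]
      simp only [Matrix.mul_assoc]
      rw [Matrix.trace_mul_comm T]
      simp only [Matrix.mul_assoc]
    have e2 : ∑ z, (σ z * (T * T) * (σ z * (T * T))).trace.re =
        ∑ x, μ x * ∑ x', if g x' = g x then (if 0 < μ x then W₀ x else fun x' => w x' / w₁) x'
          else 0 := by
      have e3 : ∀ z, (σ z * (T * T) * (σ z * (T * T))).trace.re =
          ∑ x, if g x = z then μ x * ∑ x', if g x' = z then W₀ x x' else 0 else 0 := by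
        intro z
        have : σ z * (T * T) * (σ z * (T * T)) = σ z * ((T * T) * σ z * (T * T)) := by
          simp only [Matrix.mul_assoc]
        rw [this]
        -- The PGM of the grouped ensemble is the grouped PGM, so one guess serves every `g`.
        have hM' : (T * T) * σ z * (T * T) = ∑ x', if g x' = z then M x' else 0 := by
          simp only [σ, Finset.mul_sum, Finset.sum_mul]
          refine Finset.sum_congr rfl fun x _ => ?_
          split_ifs <;> simp [M]
        rw [hM']
        simp only [σ, Finset.sum_mul, Finset.mul_sum, Matrix.trace_sum, Complex.re_sum]
        refine Finset.sum_congr rfl fun x _ => ?_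
        split_ifs with hx
        · refine Finset.sum_congr rfl fun x' _ => ?_
          split_ifs
          · rw [Matrix.smul_mul, Matrix.trace_smul, Complex.smul_re, smul_eq_mul, hsymm]
          · simp
        · simp
      rw [Finset.sum_congr rfl fun z _ => e3 z, Finset.sum_comm]
      refine Finset.sum_congr rfl fun x _ => ?_
      rw [Finset.sum_ite_eq, if_pos (Finset.mem_univ _)]
      rcases (hμ0 x).eq_or_lt with h | h
      · simp [← h]
      · simp [h]
    rw [e1, e2] at h
    exact h

/-! ### Operators dominating states -/

section StateBounds

lemma dotProduct_conjTranspose_mul_self_mulVec {k n : Type*} [Fintype k] [Fintype n]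
    (S : Matrix k n ℂ) (w : n → ℂ) :
    star w ⬝ᵥ ((Sᴴ * S) *ᵥ w) = ((∑ i, ‖(S *ᵥ w) i‖ ^ 2 : ℝ) : ℂ) := by
  rw [← Matrix.mulVec_mulVec, Matrix.dotProduct_mulVec, Matrix.vecMul_conjTranspose, star_star]
  simp only [dotProduct, Pi.star_apply, Complex.ofReal_sum]
  refine Finset.sum_congr rfl fun i _ => ?_
  rw [Complex.star_def, Complex.conj_mul']
  push_cast
  rfl

lemma norm_sum_mul_sq_le {n : Type*} [Fintype n] (v w : n → ℂ) :
    ‖∑ i, v i * w i‖ ^ 2 ≤ (∑ i, ‖v i‖ ^ 2) * ∑ i, ‖w i‖ ^ 2 := by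
  have h1 : ‖∑ i, v i * w i‖ ≤ ∑ i, ‖v i‖ * ‖w i‖ := by
    refine (norm_sum_le _ _).trans (le_of_eq ?_)
    simp only [norm_mul]
  calc ‖∑ i, v i * w i‖ ^ 2 ≤ (∑ i, ‖v i‖ * ‖w i‖) ^ 2 := by gcongr
    _ ≤ _ := Finset.sum_mul_sq_le_sq_mul_sq _ _ _

/-- A density matrix is at most the identity. -/
lemma posSemidef_one_sub {n : Type*} [Fintype n] [DecidableEq n] {A : Matrix n n ℂ}
    (hA : A.PosSemidef) (htr : A.trace = 1) : (1 - A).PosSemidef := by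
  refine Matrix.PosSemidef.of_dotProduct_mulVec_nonneg (Matrix.isHermitian_one.sub hA.1) fun w => ?_
  obtain ⟨S, hS, rfl⟩ := exists_hermitian_sq hA
  have h1 := dotProduct_conjTranspose_mul_self_mulVec (1 : Matrix n n ℂ) w
  have h2 := dotProduct_conjTranspose_mul_self_mulVec S w
  rw [Matrix.conjTranspose_one, Matrix.one_mul] at h1
  rw [hS.eq] at h2
  rw [Matrix.sub_mulVec, dotProduct_sub, h1, h2, ← Complex.ofReal_sub, Complex.zero_le_real,
    sub_nonneg, Matrix.one_mulVec]
  -- The trace of `S * S` is the squared Frobenius norm of `S`, which bounds its operator norm.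
  have h3 : ∑ i, ∑ j, ‖S i j‖ ^ 2 = 1 := by
    have h4 : (S * S).trace = ((∑ i, ∑ j, ‖S i j‖ ^ 2 : ℝ) : ℂ) := by
      have h5 : S * S = Sᴴ * S := by rw [hS.eq]
      rw [h5]
      simp only [Matrix.trace, Matrix.diag, Matrix.mul_apply, Matrix.conjTranspose_apply]
      rw [Finset.sum_comm]
      push_cast
      refine Finset.sum_congr rfl fun i _ => Finset.sum_congr rfl fun j _ => ?_
      rw [Complex.star_def, Complex.conj_mul']
    rw [h4] at htr
    exact_mod_cast htr
  calc ∑ i, ‖(S *ᵥ w) i‖ ^ 2 ≤ ∑ i, (∑ j, ‖S i j‖ ^ 2) * ∑ j, ‖w j‖ ^ 2 :=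
        Finset.sum_le_sum fun i _ => norm_sum_mul_sq_le _ _
    _ = ∑ j, ‖w j‖ ^ 2 := by rw [← Finset.sum_mul, h3, one_mul]

variable {m b : Type*} [Fintype m]

/-- The partial trace over the first factor. -/
def partialTrace (A : Matrix (m × b) (m × b) ℂ) : Matrix b b ℂ :=
  fun i j => ∑ l, A (l, i) (l, j)

lemma partialTrace_conjTranspose_mul_self {k : Type*} [Fintype k] (S : Matrix k (m × b) ℂ) :
    partialTrace (Sᴴ * S) =
      ∑ l, (Matrix.of fun i j => S i (l, j))ᴴ * (Matrix.of fun i j => S i (l, j)) := by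
  ext i j
  simp [partialTrace, Matrix.mul_apply, Matrix.sum_apply]

variable [Fintype b]

lemma trace_partialTrace (A : Matrix (m × b) (m × b) ℂ) : (partialTrace A).trace = A.trace := by
  simp only [Matrix.trace, partialTrace, Matrix.diag, Fintype.sum_prod_type]
  exact Finset.sum_comm

lemma partialTrace_posSemidef [DecidableEq m] [DecidableEq b] {A : Matrix (m × b) (m × b) ℂ}
    (hA : A.PosSemidef) : (partialTrace A).PosSemidef := by
  obtain ⟨S, hS, rfl⟩ := exists_hermitian_sq hA
  conv => arg 1; arg 1; arg 1; rw [← hS.eq]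
  rw [partialTrace_conjTranspose_mul_self]
  exact Matrix.posSemidef_sum _ fun l _ => Matrix.posSemidef_conjTranspose_mul_self _

lemma dotProduct_one_kronecker_mulVec [DecidableEq m] (N : Matrix b b ℂ) (w : m × b → ℂ) :
    star w ⬝ᵥ (((1 : Matrix m m ℂ) ⊗ₖ N) *ᵥ w) =
      ∑ l, star (fun i => w (l, i)) ⬝ᵥ (N *ᵥ fun i => w (l, i)) := by
  simp [dotProduct, Matrix.mulVec, Fintype.sum_prod_type, Matrix.one_apply, ite_mul]

/-- A bipartite state is at most `|m|` times the product of the identity with its marginal. -/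
theorem posSemidef_card_smul_kronecker_sub [DecidableEq m] [DecidableEq b]
    {A : Matrix (m × b) (m × b) ℂ} (hA : A.PosSemidef) :
    ((Fintype.card m : ℝ) • ((1 : Matrix m m ℂ) ⊗ₖ partialTrace A) - A).PosSemidef := by
  have hH : ((Fintype.card m : ℝ) • ((1 : Matrix m m ℂ) ⊗ₖ partialTrace A)).PosSemidef :=
    (Matrix.PosSemidef.one.kronecker (partialTrace_posSemidef hA)).smul (Nat.cast_nonneg _)
  refine Matrix.PosSemidef.of_dotProduct_mulVec_nonneg (hH.1.sub hA.1) fun w => ?_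
  obtain ⟨S, hS, rfl⟩ := exists_hermitian_sq hA
  have h2 := dotProduct_conjTranspose_mul_self_mulVec S w
  have h3 := partialTrace_conjTranspose_mul_self S
  rw [hS.eq] at h2 h3
  rw [Matrix.sub_mulVec, dotProduct_sub, Matrix.smul_mulVec, dotProduct_smul,
    dotProduct_one_kronecker_mulVec, h2, h3]
  simp only [Matrix.sum_mulVec, dotProduct_sum, dotProduct_conjTranspose_mul_self_mulVec]
  -- `S w` is the sum over `l` of `S_l w_l` for the column blocks `S_l`; Cauchy–Schwarz over `l`
  -- costs `|m|`. Next, `‖S_l w_l‖²` is bounded by the sum of `‖S_l' w_l‖²` over all `l'`, which is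
  -- the form of the marginal at `w_l`.
  have h4 : ∀ k, ‖(S *ᵥ w) k‖ ^ 2 ≤ Fintype.card m *
      ∑ l, ‖((Matrix.of fun i j => S i (l, j)) *ᵥ fun i => w (l, i)) k‖ ^ 2 := by
    intro k
    have : (S *ᵥ w) k =
        ∑ l, 1 * ((Matrix.of fun i j => S i (l, j)) *ᵥ fun i => w (l, i)) k := by
      simp [Matrix.mulVec, dotProduct, Fintype.sum_prod_type]
    rw [this]
    refine (norm_sum_mul_sq_le _ _).trans (le_of_eq ?_)
    simp
  have h5 : ∑ k, ‖(S *ᵥ w) k‖ ^ 2 ≤ (Fintype.card m : ℝ) * ∑ l, ∑ l', ∑ k,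
      ‖((Matrix.of fun i j => S i (l', j)) *ᵥ fun i => w (l, i)) k‖ ^ 2 := by
    calc ∑ k, ‖(S *ᵥ w) k‖ ^ 2 ≤ ∑ k, (Fintype.card m *
        ∑ l, ‖((Matrix.of fun i j => S i (l, j)) *ᵥ fun i => w (l, i)) k‖ ^ 2 : ℝ) :=
          Finset.sum_le_sum fun k _ => h4 k
      _ = Fintype.card m * ∑ l, ∑ k,
          ‖((Matrix.of fun i j => S i (l, j)) *ᵥ fun i => w (l, i)) k‖ ^ 2 := by
        rw [← Finset.mul_sum, Finset.sum_comm]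
      _ ≤ _ := by
        gcongr with l _
        exact Finset.single_le_sum (f := fun l' => ∑ k,
          ‖((Matrix.of fun i j => S i (l', j)) *ᵥ fun i => w (l, i)) k‖ ^ 2)
          (fun _ _ => by positivity) (Finset.mem_univ l)
  have h6 := Complex.zero_le_real.2 (sub_nonneg.2 h5)
  rw [Complex.real_smul]
  push_cast at h6 ⊢
  exact h6

end StateBounds

/-! ### The joint state in an entanglement-assisted protocol -/

section EntangledState

variable {X Y Z : Type*} [Fintype Z] {q : ℕ} (P : EntangledProtocol X Y Z q)

lemma EntangledProtocol.state_posSemidef (x : X) : (P.state x).PosSemidef :=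
  Matrix.posSemidef_sum _ fun _ _ =>
    (Matrix.posSemidef_vecMulVec_self_star P.ψ).mul_mul_conjTranspose_same _

/-- Bob's part of the shared state. -/
def EntangledProtocol.bobState : Matrix (Fin P.b) (Fin P.b) ℂ :=
  ((Matrix.of fun i j => P.ψ (i, j))ᴴ * Matrix.of fun i j => P.ψ (i, j))ᵀ

/-- No signalling: Alice's channel preserves the trace, so Bob's marginal is independent of `x`.
This lets a single `τ` dominate all the states. -/
lemma EntangledProtocol.partialTrace_state (x : X) :
    partialTrace (P.state x) = P.bobState := by
  set Ψ : Matrix (Fin P.a) (Fin P.b) ℂ := Matrix.of fun i j => P.ψ (i, j) with hΨ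
  have h1 : ∀ i, (P.K x i ⊗ₖ (1 : Matrix (Fin P.b) (Fin P.b) ℂ)) *ᵥ P.ψ =
      fun lj => (P.K x i * Ψ) lj.1 lj.2 := by
    intro i
    ext ⟨l, j⟩
    simp [Matrix.mulVec, dotProduct, Fintype.sum_prod_type, Matrix.one_apply, Matrix.mul_apply, hΨ]
  have h2 : P.bobState = (∑ i, (P.K x i * Ψ)ᴴ * (P.K x i * Ψ))ᵀ := by
    have : ∀ i, (P.K x i * Ψ)ᴴ * (P.K x i * Ψ) = Ψᴴ * ((P.K x i)ᴴ * P.K x i) * Ψ := by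
      intro i
      rw [Matrix.conjTranspose_mul]
      simp only [Matrix.mul_assoc]
    simp only [this]
    rw [← Matrix.sum_mul, ← Matrix.mul_sum, P.K_sum, Matrix.mul_one]
    rfl
  rw [h2]
  ext j j'
  simp only [partialTrace, EntangledProtocol.state, Matrix.mul_vecMulVec, Matrix.vecMulVec_mul,
    ← Matrix.star_mulVec, h1, Matrix.sum_apply, Matrix.transpose_apply, Matrix.vecMulVec_apply,
    Matrix.mul_apply (M := (_ : Matrix _ _ ℂ)ᴴ), Matrix.conjTranspose_apply, Pi.star_apply]
  rw [Finset.sum_comm]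
  exact Finset.sum_congr rfl fun _ _ => Finset.sum_congr rfl fun _ _ => mul_comm _ _

lemma EntangledProtocol.trace_bobState : P.bobState.trace = 1 := by
  rw [EntangledProtocol.bobState, Matrix.trace_transpose]
  simp only [Matrix.trace, Matrix.diag, Matrix.mul_apply, Matrix.conjTranspose_apply,
    Matrix.of_apply, Complex.star_def, Complex.conj_mul']
  rw [Finset.sum_comm, ← Fintype.sum_prod_type (f := fun i => ((‖P.ψ i‖ : ℂ)) ^ 2)]
  exact_mod_cast P.ψ_norm

end EntangledState

/-! ### Rejection sampling with public candidates -/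

section RejectionSampling

universe u

variable {X : Type u} [Fintype X] [DecidableEq X]

/-- Rejection sampling with a public list of `N` candidates drawn from `ν`: on input `x`, some
index `m` is selected with probability `alice r x m`, and the selected candidate has law `W x`,
up to the factor `1 - (1 - 1 / K) ^ N`, the probability that a candidate is accepted. -/
theorem exists_rejection_sampler {W : X → X → ℝ} {ν : X → ℝ} {K : ℝ}
    (hν : ν ∈ stdSimplex ℝ X) (hW : ∀ x, W x ∈ stdSimplex ℝ X) (hK : 0 < K)
    (hWν : ∀ x x', W x x' ≤ K * ν x') (N : ℕ) :
    ∃ (R : Type u) (_ : Fintype R) (pub : R → ℝ) (alice : R → X → Fin N → ℝ)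
      (v : R → Fin N → X), pub ∈ stdSimplex ℝ R ∧ (∀ r x m, 0 ≤ alice r x m) ∧
      (∀ r x, ∑ m, alice r x m ≤ 1) ∧
      ∀ x x', ∑ r, pub r * ∑ m, alice r x m * (if v r m = x' then 1 else 0) =
        (1 - (1 - 1 / K) ^ N) * W x x' := by
  induction N with
  | zero =>
    exact ⟨PUnit, inferInstance, fun _ => 1, fun _ _ _ => 0, fun _ m => m.elim0,
      ⟨by simp, by simp⟩, by simp, by simp, by simp⟩
  | succ N ih =>
    obtain ⟨R, hR, pub, alice, v, hpub, ha0, ha1, hlaw⟩ := ih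
    -- The acceptance probability. Where `ν w = 0` it is `0` by convention, harmlessly since `W x w
    -- = 0` there.
    let a : X → X → ℝ := fun x w => W x w / (K * ν w)
    have hKν : ∀ w, 0 ≤ K * ν w := fun w => mul_nonneg hK.le (hν.1 w)
    have ha0' : ∀ x w, 0 ≤ a x w := fun x w => div_nonneg ((hW x).1 w) (hKν w)
    have ha1' : ∀ x w, a x w ≤ 1 := fun x w => div_le_one_of_le₀ (hWν x w) (hKν w)
    have hνa : ∀ x w, ν w * a x w = W x w / K := by
      intro x w
      rcases (hν.1 w).eq_or_lt with h | h
      · have h1 := hWν x w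
        rw [← h, mul_zero] at h1
        rw [← h, le_antisymm h1 ((hW x).1 w), zero_mul, zero_div]
      · have := h.ne'
        simp only [a]
        field_simp
    have hνa1 : ∀ x, ∑ w, ν w * (1 - a x w) = 1 - 1 / K := by
      intro x
      simp only [mul_sub, mul_one, hνa, Finset.sum_sub_distrib, ← Finset.sum_div]
      rw [hν.2, (hW x).2]
    -- The new candidate is tried first and accepted with overall probability `1 / K`; on rejection
    -- the old sampler runs.
    refine ⟨R × X, inferInstance, fun rw => pub rw.1 * ν rw.2,
      fun rw x => Fin.cons (a x rw.2) fun m => (1 - a x rw.2) * alice rw.1 x m,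
      fun rw => Fin.cons rw.2 (v rw.1), ⟨fun rw => mul_nonneg (hpub.1 _) (hν.1 _), ?_⟩, ?_, ?_, ?_⟩
    · rw [Fintype.sum_prod_type]
      simp only [← Finset.mul_sum, hν.2, mul_one]
      exact hpub.2
    · rintro ⟨r, w⟩ x m
      refine Fin.cases ?_ (fun m => ?_) m
      · exact ha0' x w
      · exact mul_nonneg (sub_nonneg.2 (ha1' x w)) (ha0 r x m)
    · rintro ⟨r, w⟩ x
      simp only [Fin.sum_univ_succ, Fin.cons_zero, Fin.cons_succ, ← Finset.mul_sum]
      have := mul_le_mul_of_nonneg_left (ha1 r x) (sub_nonneg.2 (ha1' x w))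
      linarith
    · intro x x'
      simp only [Fintype.sum_prod_type, Fin.sum_univ_succ, Fin.cons_zero, Fin.cons_succ, mul_add,
        Finset.sum_add_distrib]
      have e1 : ∑ r, ∑ w, pub r * ν w * (a x w * if w = x' then 1 else 0) = W x x' / K := by
        have : ∀ r w, pub r * ν w * (a x w * if w = x' then 1 else 0) =
            pub r * if w = x' then W x w / K else 0 := by
          intro r w
          rw [← hνa]
          split_ifs <;> ring
        simp only [this, ← Finset.mul_sum, Finset.sum_ite_eq', Finset.mem_univ, if_true]
        rw [← Finset.sum_mul, hpub.2, one_mul]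
      have e2 : ∑ r, ∑ w, pub r * ν w *
          ∑ m, (1 - a x w) * alice r x m * (if v r m = x' then 1 else 0) =
          (1 - 1 / K) * ((1 - (1 - 1 / K) ^ N) * W x x') := by
        rw [← hlaw, ← hνa1 x, Finset.sum_comm, Finset.sum_mul]
        refine Finset.sum_congr rfl fun w _ => ?_
        rw [Finset.mul_sum]
        refine Finset.sum_congr rfl fun r _ => ?_
        simp only [mul_assoc, ← Finset.mul_sum]
        ring
      rw [e1, e2]
      ring

/-- Communication of a sample: if the laws `W x` have densities at most `K` with respect to a
common law, then a protocol with `c` bits lets Bob apply `h` to a sample of `W x`, up to the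
probability `(1 - 1 / K) ^ 2 ^ c` that the sampling fails. -/
theorem exists_sampling_protocol {Y Z : Type*} [Fintype Z] [DecidableEq Z]
    {W : X → X → ℝ} {ν : X → ℝ} {K : ℝ}
    (hν : ν ∈ stdSimplex ℝ X) (hW : ∀ x, W x ∈ stdSimplex ℝ X) (hK : 1 ≤ K)
    (hWν : ∀ x x', W x x' ≤ K * ν x') (c : ℕ) (h : X → Y → Z) :
    ∃ P : ClassicalProtocol X Y Z c, ∀ x y z,
      (∑ x', if h x' y = z then W x x' else 0) - (1 - 1 / K) ^ 2 ^ c ≤ P.out x y z := by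
  obtain ⟨R, hR, pub, alice, v, hpub, ha0, ha1, hlaw⟩ :=
    exists_rejection_sampler hν hW (by linarith) hWν (2 ^ c)
  let e : Fin (Fintype.card R) ≃ R := (Fintype.equivFin R).symm
  let i : (Fin c → Bool) ≃ Fin (2 ^ c) := Fintype.equivFinOfCardEq (by simp)
  -- The mass of failed sampling goes to an arbitrary message; this can only increase each output
  -- probability.
  let A : R → X → (Fin c → Bool) → ℝ := fun r x m =>
    alice r x (i m) + if m = fun _ => false then 1 - ∑ m, alice r x m else 0
  have hA : ∀ r x m, alice r x (i m) ≤ A r x m := by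
    intro r x m
    refine le_add_of_nonneg_right ?_
    split_ifs
    · exact sub_nonneg.2 (ha1 r x)
    · exact le_rfl
  let P : ClassicalProtocol X Y Z c :=
    { seeds := Fintype.card R
      pub := fun r => pub (e r)
      pub_mem := ⟨fun r => hpub.1 _, (Equiv.sum_comp e pub).trans hpub.2⟩
      alice := fun r => A (e r)
      alice_mem := fun r x => ⟨fun m => (ha0 _ _ _).trans (hA _ _ _), by
        simp only [A, Finset.sum_add_distrib, Finset.sum_ite_eq', Finset.mem_univ, if_true]
        rw [Equiv.sum_comp i (alice (e r) x)]
        ring⟩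
      bob := fun r m y => Pi.single (h (v (e r) (i m)) y) 1
      bob_mem := fun r m y => single_mem_stdSimplex ℝ _ }
  refine ⟨P, fun x y z => ?_⟩
  have hfail : 0 ≤ (1 - 1 / K) ^ 2 ^ c := by
    refine pow_nonneg (sub_nonneg.2 ?_) _
    exact div_le_one_of_le₀ hK (by linarith)
  have hS : (∑ x', if h x' y = z then W x x' else 0) ≤ 1 := by
    rw [← (hW x).2]
    refine Finset.sum_le_sum fun x' _ => ?_
    split_ifs
    · exact le_rfl
    · exact (hW x).1 x'
  have h1 : P.out x y z =
      ∑ r, pub r * ∑ m, A r x m * (if h (v r (i m)) y = z then 1 else 0) := by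
    rw [← Equiv.sum_comp e]
    simp only [ClassicalProtocol.out, P, Pi.single_apply, eq_comm (a := z)]
  have h2 : ∑ r, pub r * ∑ m, alice r x m * (if h (v r m) y = z then 1 else 0) ≤ P.out x y z := by
    rw [h1]
    refine Finset.sum_le_sum fun r _ => mul_le_mul_of_nonneg_left ?_ (hpub.1 r)
    rw [← Equiv.sum_comp i]
    refine Finset.sum_le_sum fun m _ => mul_le_mul_of_nonneg_right (hA r x m) ?_
    split_ifs <;> norm_num
  have h3 : ∑ r, pub r * ∑ m, alice r x m * (if h (v r m) y = z then 1 else 0) =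
      (1 - (1 - 1 / K) ^ 2 ^ c) * ∑ x', if h x' y = z then W x x' else 0 := by
    have h4 : ∀ w, (if h w y = z then (1 : ℝ) else 0) =
        ∑ x', if h x' y = z then (if w = x' then 1 else 0) else 0 := by
      intro w
      rw [Finset.sum_eq_single w]
      · simp
      · intro x' _ hx'
        simp [Ne.symm hx']
      · simp
    have h5 : ∀ x', (1 - (1 - 1 / K) ^ 2 ^ c) * (if h x' y = z then W x x' else 0) =
        ∑ r, pub r * ∑ m, alice r x m *
          (if h x' y = z then (if v r m = x' then 1 else 0) else 0) := by
      intro x'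
      split_ifs
      · exact (hlaw x x').symm
      · simp
    rw [Finset.mul_sum, Finset.sum_congr rfl fun x' _ => h5 x', Finset.sum_comm]
    refine Finset.sum_congr rfl fun r _ => ?_
    rw [← Finset.mul_sum, Finset.sum_comm]
    congr 1
    refine Finset.sum_congr rfl fun m _ => ?_
    rw [← Finset.mul_sum, h4]
  rw [h3] at h2
  have h6 := mul_le_mul_of_nonneg_left hS hfail
  linarith

end RejectionSampling

/-! ### Failure probability and the `log log` term -/

/-- With `2 ^ (k + s)` candidates, rejection sampling with acceptance probability `2 ^ (-k)` fails
with probability at most `exp (- 2 ^ s)`. -/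
lemma rejection_failure_le (k s : ℕ) :
    (1 - 1 / (2 : ℝ) ^ k) ^ 2 ^ (k + s) ≤ Real.exp (-(2 : ℝ) ^ s) := by
  have hk : (1 : ℝ) ≤ 2 ^ k := one_le_pow₀ (by norm_num)
  have h0 : 0 ≤ 1 - 1 / (2 : ℝ) ^ k := sub_nonneg.2 (div_le_one_of_le₀ hk (by positivity))
  refine (pow_le_pow_left₀ h0 (Real.one_sub_le_exp_neg _) _).trans (le_of_eq ?_)
  rw [← Real.exp_nat_mul]
  congr 1
  push_cast
  rw [pow_add]
  field_simp

lemma one_le_logLog (η : ℝ) : 1 ≤ logLog η := by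
  rw [logLog, Real.le_logb_iff_rpow_le (by norm_num) (by positivity), Real.rpow_one]
  exact le_max_left _ _

lemma exp_neg_two_pow_ceil_logLog_le {η : ℝ} (hη : 0 < η) :
    Real.exp (-(2 : ℝ) ^ ⌈logLog η⌉₊) ≤ η := by
  have h1 : max 2 (Real.logb 2 (1 / η)) ≤ (2 : ℝ) ^ ⌈logLog η⌉₊ := by
    have h : (2 : ℝ) ^ logLog η = max 2 (Real.logb 2 (1 / η)) :=
      Real.rpow_logb (by norm_num) (by norm_num) (by positivity)
    rw [← h, ← Real.rpow_natCast]
    exact Real.rpow_le_rpow_of_exponent_le (by norm_num) (Nat.le_ceil _)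
  have h2 : Real.log (1 / η) ≤ (2 : ℝ) ^ ⌈logLog η⌉₊ := by
    rcases le_or_gt 1 η with h | h
    · exact (Real.log_nonpos (by positivity) ((div_le_one hη).2 h)).trans (by positivity)
    · refine le_trans ?_ ((le_max_right _ _).trans h1)
      have h3 : 0 ≤ Real.log (1 / η) := Real.log_nonneg ((one_le_div hη).2 h.le)
      rw [Real.logb]
      refine le_div_self h3 (Real.log_pos (by norm_num)) ?_
      linarith [Real.log_two_lt_d9]
  calc Real.exp (-(2 : ℝ) ^ ⌈logLog η⌉₊) ≤ Real.exp (-Real.log (1 / η)) := by gcongr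
    _ = η := by rw [one_div, Real.log_inv, neg_neg, Real.exp_log hη]

/-! ### Monotonicity and concavity of the error bound -/

section ErrorBound

/-- Error of the pretty good measurement for `d` alternatives, in terms of the optimal error. -/
noncomputable def prettyGoodErr (d e : ℝ) : ℝ := 1 - (1 / d + d / (d - 1) * (1 - e - 1 / d) ^ 2)

lemma prettyGoodErr_eq {d ε : ℝ} (hd : 1 ≤ d) (hε : 0 ≤ ε) (hε' : ε ≤ 1 - 1 / d) :
    prettyGoodErr d ε = 2 * ε - d * ε ^ 2 / (d - 1) := by
  rw [prettyGoodErr]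
  rcases hd.eq_or_lt with h | h
  · rw [← h] at hε' ⊢
    norm_num at hε' ⊢
    linarith
  · have h1 : d - 1 ≠ 0 := by linarith
    have h2 : d ≠ 0 := by linarith
    field_simp
    ring

/-- The square `(1 - e - 1/d)^2` decreases in `e` only up to `1 - 1/d`, hence the restriction on
`ε`. -/
lemma prettyGoodErr_mono {d e ε : ℝ} (hd : 1 ≤ d) (he : e ≤ ε) (hε : ε ≤ 1 - 1 / d) :
    prettyGoodErr d e ≤ prettyGoodErr d ε := by
  have h : (1 - ε - 1 / d) ^ 2 ≤ (1 - e - 1 / d) ^ 2 :=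
    pow_le_pow_left₀ (by linarith) (by linarith) 2
  have h1 : 0 ≤ d / (d - 1) := div_nonneg (by linarith) (by linarith)
  have h2 := mul_le_mul_of_nonneg_left h h1
  rw [prettyGoodErr, prettyGoodErr]
  linarith

lemma prettyGoodErr_nonneg {d ε : ℝ} (hd : 1 ≤ d) (hε : 0 ≤ ε) (hε' : ε ≤ 1 - 1 / d) :
    0 ≤ prettyGoodErr d ε := by
  refine le_trans ?_ (prettyGoodErr_mono hd hε hε')
  rw [prettyGoodErr_eq hd le_rfl (hε.trans hε')]
  simp

/-- Jensen for a concave quadratic, by its tangent at the mean `m`. -/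
lemma sum_prettyGoodErr_le {Y : Type*} [Fintype Y] {d : ℝ} (hd : 1 ≤ d) {ν : Y → ℝ}
    (hν : ν ∈ stdSimplex ℝ Y) (e : Y → ℝ) :
    ∑ y, ν y * prettyGoodErr d (e y) ≤ prettyGoodErr d (∑ y, ν y * e y) := by
  set m := ∑ y, ν y * e y with hm
  have h1 : 0 ≤ d / (d - 1) := div_nonneg (by linarith) (by linarith)
  have h2 : ∀ y, ν y * prettyGoodErr d (e y) ≤ ν y * prettyGoodErr d m +
      2 * (d / (d - 1) * (1 - m - 1 / d)) * (ν y * e y - ν y * m) := by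
    intro y
    have h3 := mul_nonneg (mul_nonneg (hν.1 y) h1) (sq_nonneg (e y - m))
    simp only [prettyGoodErr]
    linarith
  refine (Finset.sum_le_sum fun y _ => h2 y).trans (le_of_eq ?_)
  rw [Finset.sum_add_distrib, ← Finset.sum_mul, hν.2, ← Finset.mul_sum, Finset.sum_sub_distrib,
    ← Finset.sum_mul, hν.2, ← hm]
  ring

end ErrorBound

/-! ### Classical simulation of quantum protocols -/

section Simulation

universe u v w

variable {X : Type u} {Y : Type v} {Z : Type w} [Fintype Z]

lemma ClassicalProtocol.sum_out {c : ℕ} (P : ClassicalProtocol X Y Z c) (x : X) (y : Y) :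
    ∑ z, P.out x y z = 1 := by
  simp only [ClassicalProtocol.out]
  rw [Finset.sum_comm]
  simp only [← Finset.mul_sum]
  have h : ∀ r, ∑ z, ∑ m, P.alice r x m * P.bob r m y z = 1 := by
    intro r
    rw [Finset.sum_comm]
    simp only [← Finset.mul_sum, (P.bob_mem r _ y).2, mul_one]
    exact (P.alice_mem r x).2
  simp only [h, mul_one]
  exact P.pub_mem.2

lemma QuantumProtocol.sum_out {q : ℕ} (P : QuantumProtocol X Y Z q) (x : X) (y : Y) :
    ∑ z, P.out x y z = 1 := by
  simp only [QuantumProtocol.out]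
  rw [← Complex.re_sum, ← Matrix.trace_sum, ← Finset.sum_mul, P.E_sum, Matrix.one_mul, P.ρ_trace,
    Complex.one_re]

lemma EntangledProtocol.trace_state {q : ℕ} (P : EntangledProtocol X Y Z q) (x : X) :
    (P.state x).trace = 1 := by
  rw [← trace_partialTrace, P.partialTrace_state, P.trace_bobState]

lemma EntangledProtocol.sum_out {q : ℕ} (P : EntangledProtocol X Y Z q) (x : X) (y : Y) :
    ∑ z, P.out x y z = 1 := by
  simp only [EntangledProtocol.out]
  rw [← Complex.re_sum, ← Matrix.trace_sum, ← Finset.sum_mul, P.E_sum, Matrix.one_mul,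
    P.trace_state, Complex.one_re]

variable [DecidableEq Z]

lemma errAt_eq_one_sub {f : X → Y → Option Z} {out : X → Y → Z → ℝ} {x : X} {y : Y} {z : Z}
    (h : f x y = some z) (hout : ∑ z, out x y z = 1) : errAt f out x y = 1 - out x y z := by
  simp only [errAt, h]
  rw [← hout, Finset.filter_ne', ← Finset.add_sum_erase _ _ (Finset.mem_univ z)]
  ring

variable [Fintype X]

/-- Classical simulation of a family of states dominated by `τ`, followed by measurements `E y`. -/
theorem exists_classical_simulation [Nonempty Z] {n : Type*} [Fintype n] [DecidableEq n]
    {ξ : X → ℝ} (hξ : ξ ∈ stdSimplex ℝ X) {ρ : X → Matrix n n ℂ}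
    (hρ : ∀ x, (ρ x).PosSemidef) (hρtr : ∀ x, (ρ x).trace = 1)
    {τ : Matrix n n ℂ} (hτ : τ.PosSemidef) (hle : ∀ x, (τ - ρ x).PosSemidef)
    {k : ℕ} (hτtr : τ.trace.re ≤ 2 ^ k) {E : Y → Z → Matrix n n ℂ}
    (hE : ∀ y z, (E y z).PosSemidef) (hEsum : ∀ y, ∑ z, E y z = 1)
    (f : X → Y → Option Z) {out : X → Y → Z → ℝ}
    (hout : ∀ x y z, out x y z = (E y z * ρ x).trace.re) (houtsum : ∀ x y, ∑ z, out x y z = 1)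
    {η : ℝ} (hη : 0 < η) :
    ∃ P : ClassicalProtocol X Y Z (k + ⌈logLog η⌉₊), ∀ y, (∀ x, ξ x ≠ 0 → f x y ≠ none) →
      ∑ x, ξ x * errAt f P.out x y ≤
        prettyGoodErr (Fintype.card Z) (∑ x, ξ x * errAt f out x y) + η := by
  classical
  obtain ⟨W, ν, hν, hW, hWν, hguess⟩ := exists_prettyGood_guess (Z := Z) hξ hρ hρtr hτ hle hτtr
  -- The default value is used only where `f` is undefined, hence for the relevant `y` only where `ξ
  -- x = 0`.
  let g : X → Y → Z := fun x y => (f x y).getD (Classical.arbitrary Z)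
  obtain ⟨P, hP⟩ := exists_sampling_protocol hν hW (one_le_pow₀ (by norm_num)) hWν
    (k + ⌈logLog η⌉₊) g
  refine ⟨P, fun y hy => ?_⟩
  have herr : ∀ (o : X → Y → Z → ℝ), (∀ x, ∑ z, o x y z = 1) →
      ∑ x, ξ x * errAt f o x y = 1 - ∑ x, ξ x * o x y (g x y) := by
    intro o ho
    rw [← hξ.2, ← Finset.sum_sub_distrib]
    refine Finset.sum_congr rfl fun x _ => ?_
    by_cases hx : ξ x = 0
    · simp [hx]
    · obtain ⟨z, hz⟩ := Option.ne_none_iff_exists'.1 (hy x hx)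
      have hg : g x y = z := by simp [g, hz]
      rw [hg, errAt_eq_one_sub hz (ho x)]
      ring
  rw [herr _ fun x => P.sum_out x y, herr _ fun x => houtsum x y, prettyGoodErr]
  have h1 := hguess (E y) (fun x => g x y) (hE y) (hEsum y)
  simp only [← hout] at h1
  have hfail := (rejection_failure_le k ⌈logLog η⌉₊).trans (exp_neg_two_pow_ceil_logLog_le hη)
  have h2 : ∑ x, ξ x * (∑ x', if g x' y = g x y then W x x' else 0) - η ≤
      ∑ x, ξ x * P.out x y (g x y) := by
    have h3 : η = ∑ x, ξ x * η := by rw [← Finset.sum_mul, hξ.2, one_mul]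
    conv_lhs => rw [h3]
    rw [← Finset.sum_sub_distrib]
    refine Finset.sum_le_sum fun x _ => ?_
    rw [← mul_sub]
    refine mul_le_mul_of_nonneg_left ?_ (hξ.1 x)
    linarith [hP x y (g x y)]
  rw [sub_sub_cancel]
  linarith

theorem QuantumProtocol.exists_classical_simulation [Nonempty Z] {q : ℕ}
    (P : QuantumProtocol X Y Z q) {ξ : X → ℝ} (hξ : ξ ∈ stdSimplex ℝ X)
    (f : X → Y → Option Z) {η : ℝ} (hη : 0 < η) :
    ∃ P' : ClassicalProtocol X Y Z (q + ⌈logLog η⌉₊), ∀ y, (∀ x, ξ x ≠ 0 → f x y ≠ none) →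
      ∑ x, ξ x * errAt f P'.out x y ≤
        prettyGoodErr (Fintype.card Z) (∑ x, ξ x * errAt f P.out x y) + η :=
  OneWay.exists_classical_simulation hξ P.ρ_pos P.ρ_trace Matrix.PosSemidef.one
    (fun x => posSemidef_one_sub (P.ρ_pos x) (P.ρ_trace x))
    (by rw [Matrix.trace_one, Complex.natCast_re]; simp) P.E_pos P.E_sum f (fun _ _ _ => rfl) P.sum_out hη

/-- The dominating operator `2^q (1 ⊗ ρ_B)` has trace `2^q · 2^q`: one factor from the domination
constant, one from the identity on the message. -/
theorem EntangledProtocol.exists_classical_simulation [Nonempty Z] {q : ℕ}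
    (P : EntangledProtocol X Y Z q) {ξ : X → ℝ} (hξ : ξ ∈ stdSimplex ℝ X)
    (f : X → Y → Option Z) {η : ℝ} (hη : 0 < η) :
    ∃ P' : ClassicalProtocol X Y Z (2 * q + ⌈logLog η⌉₊), ∀ y, (∀ x, ξ x ≠ 0 → f x y ≠ none) →
      ∑ x, ξ x * errAt f P'.out x y ≤
        prettyGoodErr (Fintype.card Z) (∑ x, ξ x * errAt f P.out x y) + η := by
  obtain ⟨x₀⟩ : Nonempty X := by
    by_contra h
    rw [not_nonempty_iff] at h
    simpa using hξ.2
  have hB : P.bobState.PosSemidef := by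
    rw [← P.partialTrace_state x₀]
    exact partialTrace_posSemidef (P.state_posSemidef x₀)
  refine OneWay.exists_classical_simulation hξ P.state_posSemidef P.trace_state
    (τ := (Fintype.card (Fin q → Bool) : ℝ) • ((1 : Matrix (Fin q → Bool) _ ℂ) ⊗ₖ P.bobState))
    ((Matrix.PosSemidef.one.kronecker hB).smul (Nat.cast_nonneg _)) (fun x => ?_) ?_
    P.E_pos P.E_sum f (fun _ _ _ => rfl) P.sum_out hη
  · rw [← P.partialTrace_state x]
    exact posSemidef_card_smul_kronecker_sub (P.state_posSemidef x)
  · rw [Matrix.trace_smul, Matrix.trace_kronecker, P.trace_bobState, Matrix.trace_one, mul_one,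
      Complex.smul_re, Complex.natCast_re, smul_eq_mul]
    simp [two_mul, pow_add]

lemma worstErr_le_of_simulation [Finite Y] [Nonempty Z] {ξ : X → ℝ} {T : Set Y}
    {f : X → Y → Option Z} (hf : ∀ x, ξ x ≠ 0 → ∀ y ∈ T, f x y ≠ none)
    {out out' : X → Y → Z → ℝ} {ε η : ℝ} (hε : 0 ≤ ε) (hε' : ε ≤ 1 - 1 / (Fintype.card Z : ℝ))
    (hη : 0 ≤ η)
    (h : ∀ y, (∀ x, ξ x ≠ 0 → f x y ≠ none) → ∑ x, ξ x * errAt f out' x y ≤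
      prettyGoodErr (Fintype.card Z) (∑ x, ξ x * errAt f out x y) + η)
    (hout : worstErr f ξ T out ≤ ε) :
    worstErr f ξ T out' ≤ prettyGoodErr (Fintype.card Z) ε + η := by
  have hd : (1 : ℝ) ≤ Fintype.card Z := by exact_mod_cast Fintype.card_pos
  -- The bound must be nonnegative because the supremum is `0` when `T` is empty.
  refine Real.iSup_le (fun y => (h y fun x hx => hf x hx y y.2).trans ?_)
    (add_nonneg (prettyGoodErr_nonneg hd hε hε') hη)
  gcongr
  refine prettyGoodErr_mono hd (le_trans ?_ hout) hε'
  exact le_ciSup (f := fun y : T => ∑ x, ξ x * errAt f out x y) (Set.finite_range _).bddAbove y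

variable [Fintype Y]

lemma marginalX_mem {μ : X × Y → ℝ} (hμ : μ ∈ stdSimplex ℝ (X × Y)) :
    marginalX μ ∈ stdSimplex ℝ X :=
  ⟨fun _ => Finset.sum_nonneg fun _ _ => hμ.1 _, by
    rw [← hμ.2, Fintype.sum_prod_type]; rfl⟩

lemma marginalY_mem {μ : X × Y → ℝ} (hμ : μ ∈ stdSimplex ℝ (X × Y)) :
    marginalY μ ∈ stdSimplex ℝ Y :=
  ⟨fun _ => Finset.sum_nonneg fun _ _ => hμ.1 _, by
    rw [← hμ.2, Fintype.sum_prod_type, Finset.sum_comm]; rfl⟩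

lemma avgErr_eq_of_product {μ : X × Y → ℝ} (hμ : IsProductDist μ) (f : X → Y → Option Z)
    (out : X → Y → Z → ℝ) :
    avgErr f μ out = ∑ y, marginalY μ y * ∑ x, marginalX μ x * errAt f out x y := by
  simp only [avgErr, Finset.mul_sum]
  rw [Finset.sum_comm]
  refine Finset.sum_congr rfl fun y _ => Finset.sum_congr rfl fun x _ => ?_
  rw [hμ.2 x y]
  ring

lemma avgErr_le_of_simulation [Nonempty Z] {μ : X × Y → ℝ} (hμ : IsProductDist μ)
    {f : X → Y → Option Z} (hf : ∀ x y, μ (x, y) ≠ 0 → f x y ≠ none)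
    {out out' : X → Y → Z → ℝ} {ε η : ℝ} (hε : ε ≤ 1 - 1 / (Fintype.card Z : ℝ))
    (h : ∀ y, (∀ x, marginalX μ x ≠ 0 → f x y ≠ none) →
      ∑ x, marginalX μ x * errAt f out' x y ≤
        prettyGoodErr (Fintype.card Z) (∑ x, marginalX μ x * errAt f out x y) + η)
    (hout : avgErr f μ out ≤ ε) : avgErr f μ out' ≤ prettyGoodErr (Fintype.card Z) ε + η := by
  have hd : (1 : ℝ) ≤ Fintype.card Z := by exact_mod_cast Fintype.card_pos
  have hY := marginalY_mem hμ.1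
  rw [avgErr_eq_of_product hμ] at hout ⊢
  calc ∑ y, marginalY μ y * ∑ x, marginalX μ x * errAt f out' x y
      ≤ ∑ y, (marginalY μ y * prettyGoodErr (Fintype.card Z)
          (∑ x, marginalX μ x * errAt f out x y) + marginalY μ y * η) := by
        refine Finset.sum_le_sum fun y _ => ?_
        rw [← mul_add]
        -- If `y` has positive weight, the product form makes `f(·, y)` defined on the whole support
        -- of the marginal on `X`.
        by_cases hy : marginalY μ y = 0
        · simp [hy]
        · refine mul_le_mul_of_nonneg_left (h y fun x hx => hf x y ?_) (hY.1 y)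
          rw [hμ.2]
          exact mul_ne_zero hx hy
    _ ≤ _ := by
        rw [Finset.sum_add_distrib, ← Finset.sum_mul, hY.2, one_mul]
        gcongr
        exact (sum_prettyGoodErr_le hd hY _).trans (prettyGoodErr_mono hd hout hε)

end Simulation

/-- A nonempty set of lengths attains its minimum; for an empty one the right side is `⊤`, as `a ≠
0`. -/
lemma iInf_le_mul_iInf_add {p r : ℕ → Prop} {a s : ℕ} {l : ℝ} (ha : a ≠ 0) (hs : (s : ℝ) ≤ l)
    (h : ∀ q, p q → r (a * q + s)) :
    (((⨅ (c : ℕ) (_ : r c), (c : ℕ∞)) : ℕ∞) : ℝ≥0∞) ≤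
      a * (((⨅ (q : ℕ) (_ : p q), (q : ℕ∞)) : ℕ∞) : ℝ≥0∞) + ENNReal.ofReal l := by
  classical
  by_cases hp : ∃ q, p q
  · have hmin : (⨅ (q : ℕ) (_ : p q), (q : ℕ∞)) = (Nat.find hp : ℕ) := by
      refine le_antisymm (iInf₂_le _ (Nat.find_spec hp)) (le_iInf₂ fun q hq => ?_)
      exact_mod_cast Nat.find_min' hp hq
    have hr : (⨅ (c : ℕ) (_ : r c), (c : ℕ∞)) ≤ ((a * Nat.find hp + s : ℕ) : ℕ∞) :=
      iInf₂_le _ (h _ (Nat.find_spec hp))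
    have hs' : (s : ℝ≥0∞) ≤ ENNReal.ofReal l := by
      rw [← ENNReal.ofReal_natCast]
      exact ENNReal.ofReal_le_ofReal hs
    rw [hmin]
    refine (ENat.toENNReal_le.2 hr).trans ?_
    rw [ENat.toENNReal_coe, ENat.toENNReal_coe]
    push_cast
    gcongr
  · have htop : (⨅ (q : ℕ) (_ : p q), (q : ℕ∞)) = ⊤ := by
      simp only [not_exists] at hp
      simp [hp]
    rw [htop, ENat.toENNReal_top, ENNReal.mul_top (by exact_mod_cast ha), top_add]
    exact le_top

end OneWay

theorem theorem1 :
    ∃ C : ℝ, 0 < C ∧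
      ∀ (X Y Z : Type*) [Fintype X] [Fintype Y] [Fintype Z] [DecidableEq Z]
        (f : X → Y → Option Z) (μ : X × Y → ℝ) (ε η : ℝ),
        OneWay.IsProductDist μ →
        (∀ x y, μ (x, y) ≠ 0 → f x y ≠ none) →
        0 < η → 0 ≤ ε → ε ≤ 1 - 1 / (Fintype.card Z : ℝ) →
        let d : ℝ := Fintype.card Z
        let ε' : ℝ := 2 * ε - d * ε ^ 2 / (d - 1) + η
        let L : ℝ≥0∞ := ENNReal.ofReal (C * OneWay.logLog η)
        let μX : X → ℝ := OneWay.marginalX μ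
        ((OneWay.RAvg f μ ε' : ℕ∞) : ℝ≥0∞) ≤ 2 * ((OneWay.QEntAvg f μ ε : ℕ∞) : ℝ≥0∞) + L ∧
        ((OneWay.RAvg f μ ε' : ℕ∞) : ℝ≥0∞) ≤ ((OneWay.QAvg f μ ε : ℕ∞) : ℝ≥0∞) + L ∧
        ∀ T : Set Y, (∀ x, μX x ≠ 0 → ∀ y ∈ T, f x y ≠ none) →
          ((OneWay.RWorst f μX T ε' : ℕ∞) : ℝ≥0∞) ≤
            2 * ((OneWay.QEntWorst f μX T ε : ℕ∞) : ℝ≥0∞) + L ∧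
          ((OneWay.RWorst f μX T ε' : ℕ∞) : ℝ≥0∞) ≤
            ((OneWay.QWorst f μX T ε : ℕ∞) : ℝ≥0∞) + L := by
  -- `C = 2` absorbs the rounding: `⌈logLog η⌉₊ ≤ logLog η + 1 ≤ 2 * logLog η`, since `logLog η ≥
  -- 1`.
  refine ⟨2, two_pos, ?_⟩
  intro X Y Z _ _ _ _ f μ ε η hμ hf hη hε hε' d ε' L μX
  have hZ : Nonempty Z := by
    by_contra hZ
    have h0 : ∀ xy, μ xy = 0 := by
      rintro ⟨x, y⟩
      by_contra h
      obtain ⟨z, -⟩ := Option.ne_none_iff_exists'.1 (hf x y h)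
      exact hZ ⟨z⟩
    have h1 := hμ.1.2
    simp [h0] at h1
  have hd : 1 ≤ d := by
    simp only [d]
    exact_mod_cast Fintype.card_pos
  have hε'' : ε' = OneWay.prettyGoodErr d ε + η := by
    rw [OneWay.prettyGoodErr_eq hd hε hε']
  have hX : μX ∈ stdSimplex ℝ X := OneWay.marginalX_mem hμ.1
  have hs : (⌈OneWay.logLog η⌉₊ : ℝ) ≤ 2 * OneWay.logLog η := by
    have h1 := OneWay.one_le_logLog η
    have h2 := Nat.ceil_lt_add_one (zero_le_one.trans h1)
    linarith
  rw [hε'']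
  refine ⟨?_, ?_, fun T hT => ⟨?_, ?_⟩⟩
  · refine OneWay.iInf_le_mul_iInf_add (a := 2) two_ne_zero hs ?_
    rintro q ⟨P, hP⟩
    obtain ⟨P', hP'⟩ := P.exists_classical_simulation hX f hη
    exact ⟨P', OneWay.avgErr_le_of_simulation hμ hf hε' hP' hP⟩
  · rw [← one_mul ((OneWay.QAvg f μ ε : ℕ∞) : ℝ≥0∞), ← Nat.cast_one]
    refine OneWay.iInf_le_mul_iInf_add one_ne_zero hs ?_
    rintro q ⟨P, hP⟩
    rw [one_mul]
    obtain ⟨P', hP'⟩ := P.exists_classical_simulation hX f hη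
    exact ⟨P', OneWay.avgErr_le_of_simulation hμ hf hε' hP' hP⟩
  · refine OneWay.iInf_le_mul_iInf_add (a := 2) two_ne_zero hs ?_
    rintro q ⟨P, hP⟩
    obtain ⟨P', hP'⟩ := P.exists_classical_simulation hX f hη
    exact ⟨P', OneWay.worstErr_le_of_simulation hT hε hε' hη.le hP' hP⟩
  · rw [← one_mul ((OneWay.QWorst f μX T ε : ℕ∞) : ℝ≥0∞), ← Nat.cast_one]
    refine OneWay.iInf_le_mul_iInf_add one_ne_zero hs ?_
    rintro q ⟨P, hP⟩
    rw [one_mul]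
    obtain ⟨P', hP'⟩ := P.exists_classical_simulation hX f hη
    exact ⟨P', OneWay.worstErr_le_of_simulation hT hε hε' hη.le hP' hP⟩
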